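/- Let $C\subseteq\mathbb F_2^n$ be a binary self-dual code (a linear code equal to its dual) of length $n$ and dimension $k$, with weight enumerator $W_C(x,y)=\sum_{c\in C}x^{n-\mathrm{wt}(c)}y^{\mathrm{wt}(c)}$. Put $f_C(t)=W_C(\sqrt{1+t},\sqrt{1-t})$ for $t\in[0,1]$, $h(t)=t^4-t^2+1$ and $\ell=\lfloor n/8\rfloor$. Then there are unique rational numbers $a_0,\dots,a_\ell$ with $$f_C(t)=2^k\sum_{r=0}^{\ell}a_r\,h(t)^r\quad\text{for all }t\in[0,1],$$ and they satisfy $\sum_{r=0}^\ell a_r=1$. Let $\Lambda_{\mathrm A}(C)=\frac1{\sqrt2}(\phi(C)+2\mathbb Z^n)\subset\mathbb R^n$ be the Construction A lattice of $C$, where $\phi:\mathbb F_2^n\to\{0,1\}^n\subset\mathbb Z^n$ is the natural embedding. For a lattice $\Lambda\subset\mathbb R^n$ and $\tau>0$ write $\Theta_\Lambda(i\tau)=\sum_{\lambda\in\Lambda}e^{-\pi\tau\|\lambda\|^2}$ and $\vartheta_3(i\tau)=\sum_{v\in\mathbb Z}e^{-\pi\tau v^2}$, and let $\Delta_\Lambda(\tau)=\Theta_\Lambda(i\tau)/\Theta_{\upsilon\mathbb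 Z^n}(i\tau)$, where $\mathrm{vol}(\Lambda)=\upsilon^n$, $\upsilon>0$, be the theta series ratio. A function $f$ that is differentiable on $[a,b]$ (one-sidedly at the end points) is called U-shaped on $[a,b]$ around $t_0\in[a,b]$ if $f'(t)<0$ for $a<t<t_0$, $f'(t_0)=0$, and $f'(t)>0$ for $t_0<t<b$. Suppose that $f_C$ is U-shaped on $[0,1]$ around $1/\sqrt2$. Then for all $\tau>0$ $$\vartheta_3(i\tau)^n\sum_{r=0}^{\ell}a_r\Bigl(\frac34\Bigr)^r\le\Theta_{\Lambda_{\mathrm A}(C)}(i\tau)\le\vartheta_3(i\tau)^n,$$ $\Theta_{\Lambda_{\mathrm A}(C)}(i\tau)\le\Theta_{\mathbb Z^n}(i\tau)$ and $\Delta_{\Lambda_{\mathrm A}(C)}(\tau)\le 1$; moreover $\operatorname{argmin}_{\tau>0}\Delta_{\Lambda_{\mathrm A}(C)}(\tau)=\{1\}$, that is, $\tau=1$ is the unique global minimum point of $\Delta_{\Lambda_{\mathrm A}(C)}$ on $(0,\infty)$. -/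

import Mathlib

open Real

noncomputable section

namespace SelfDualTheta

/-! ### Binary codes -/

/-- The dual of a binary linear code of length `n`. -/
def dualCode {n : ℕ} (C : Submodule (ZMod 2) (Fin n → ZMod 2)) :
    Submodule (ZMod 2) (Fin n → ZMod 2) where
  carrier := {u | ∀ v ∈ C, u ⬝ᵥ v = 0}
  add_mem' := by
    intro a b ha hb v hv
    rw [add_dotProduct, ha v hv, hb v hv, add_zero]
  zero_mem' := by
    intro v _
    exact zero_dotProduct v
  smul_mem' := by
    intro r a ha v hv
    rw [smul_dotProduct, ha v hv, smul_zero]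

/-- A binary linear code is self-dual if it equals its dual. -/
def IsSelfDual {n : ℕ} (C : Submodule (ZMod 2) (Fin n → ZMod 2)) : Prop :=
  C = dualCode C

open Classical in
/-- The weight enumerator `W_C(x, y) = ∑_{c ∈ C} x ^ (n - wt c) * y ^ (wt c)`. -/
def weightEnumerator {n : ℕ} (C : Submodule (ZMod 2) (Fin n → ZMod 2)) (x y : ℝ) : ℝ :=
  ∑ c : Fin n → ZMod 2 with c ∈ C, x ^ (n - hammingNorm c) * y ^ hammingNorm c

/-- `f_C(t) = W_C(√(1 + t), √(1 - t))`. -/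
def codeFun {n : ℕ} (C : Submodule (ZMod 2) (Fin n → ZMod 2)) (t : ℝ) : ℝ :=
  weightEnumerator C (√(1 + t)) (√(1 - t))

/-- `h(t) = t ^ 4 - t ^ 2 + 1`. -/
def hPoly (t : ℝ) : ℝ := t ^ 4 - t ^ 2 + 1

/-- `(a_0, …, a_ℓ)`, with `ℓ = ⌊n / 8⌋`, are rational coefficients with
`f_C(t) = 2 ^ k * ∑ r, a_r * h(t) ^ r` on `[0, 1]`, where `k = dim C`. -/
def IsCoeff {n : ℕ} (C : Submodule (ZMod 2) (Fin n → ZMod 2)) (a : Fin (n / 8 + 1) → ℚ) : Prop :=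
  ∀ t ∈ Set.Icc (0 : ℝ) 1,
    codeFun C t = 2 ^ Module.finrank (ZMod 2) C * ∑ r, (a r : ℝ) * hPoly t ^ (r : ℕ)

/-! ### U-shaped functions -/

/-- `f` is U-shaped on `[a, b]` around `t₀ ∈ [a, b]`: it is differentiable on `[a, b]` (one-sidedly
at the end points), its derivative vanishes at `t₀`, and in the interior of `[a, b]` it is negative
to the left of `t₀` and positive to the right of `t₀`. No sign is asked for at `a` and `b`:
the derivative of `f_C` at `0` is always `0`. -/
structure IsUShaped (f : ℝ → ℝ) (a b t₀ : ℝ) : Prop where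
  mem : t₀ ∈ Set.Icc a b
  diff : DifferentiableOn ℝ f (Set.Icc a b)
  neg : ∀ t, a < t → t < t₀ → derivWithin f (Set.Icc a b) t < 0
  zero : derivWithin f (Set.Icc a b) t₀ = 0
  pos : ∀ t, t₀ < t → t < b → 0 < derivWithin f (Set.Icc a b) t

/-! ### Lattices and theta series -/

/-- The Construction A lattice `(1 / √2) (φ(C) + 2 ℤⁿ)`, with `φ` the embedding `{0, 1} ⊂ ℤ`
applied coordinatewise. -/
def constrA {n : ℕ} (C : Submodule (ZMod 2) (Fin n → ZMod 2)) :
    Submodule ℤ (EuclideanSpace ℝ (Fin n)) where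
  carrier := {x | ∃ c ∈ C, ∃ z : Fin n → ℤ,
    ∀ i, x i = (1 / √2) * (((c i).val : ℝ) + 2 * (z i : ℝ))}
  add_mem' := by
    rintro x y ⟨c, hc, z, hx⟩ ⟨d, hd, w, hy⟩
    refine ⟨c + d, C.add_mem hc hd,
      fun i => z i + w i + (((c i).val + (d i).val) / 2 : ℕ), fun i => ?_⟩
    have key : (c i).val + (d i).val
        = ((c + d) i).val + 2 * (((c i).val + (d i).val) / 2) := by
      rw [Pi.add_apply, ZMod.val_add]
      omega
    have key' : ((c i).val : ℝ) + ((d i).val : ℝ)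
        = (((c + d) i).val : ℝ) + 2 * ((((c i).val + (d i).val) / 2 : ℕ) : ℝ) := by
      exact_mod_cast key
    rw [PiLp.add_apply, hx i, hy i]
    rw [Int.cast_add, Int.cast_add, Int.cast_natCast]
    linear_combination (1 / √2) * key'
  zero_mem' := ⟨0, C.zero_mem, 0, fun i => by simp⟩
  smul_mem' := by
    rintro m x ⟨c, hc, z, hx⟩
    refine ⟨(m : ZMod 2) • c, C.smul_mem _ hc,
      fun i => (m * ((c i).val : ℤ) - ((((m : ZMod 2) • c) i).val : ℤ)) / 2 + m * z i,
      fun i => ?_⟩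
    have hdvd : (2 : ℤ) ∣ m * ((c i).val : ℤ) - ((((m : ZMod 2) • c) i).val : ℤ) := by
      have := (ZMod.intCast_zmod_eq_zero_iff_dvd
        (m * ((c i).val : ℤ) - ((((m : ZMod 2) • c) i).val : ℤ)) 2).1 (by simp)
      exact_mod_cast this
    have key := Int.mul_ediv_cancel' hdvd
    have key' : (2 : ℝ) *
        (((m * ((c i).val : ℤ) - ((((m : ZMod 2) • c) i).val : ℤ)) / 2 : ℤ) : ℝ)
        = (m : ℝ) * ((c i).val : ℝ) - ((((m : ZMod 2) • c) i).val : ℝ) := by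
      exact_mod_cast key
    have hs : (m • x) i = (m : ℝ) * x i := by simp
    rw [hs, hx i, Int.cast_add, Int.cast_mul]
    linear_combination (-(1 / √2)) * key'

/-- The lattice `υ ℤⁿ`. -/
def scaledInt (n : ℕ) (υ : ℝ) : Submodule ℤ (EuclideanSpace ℝ (Fin n)) where
  carrier := {x | ∃ z : Fin n → ℤ, ∀ i, x i = υ * (z i : ℝ)}
  add_mem' := by
    rintro x y ⟨z, hx⟩ ⟨w, hy⟩
    refine ⟨z + w, fun i => ?_⟩
    rw [PiLp.add_apply, hx i, hy i, Pi.add_apply]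
    push_cast
    ring
  zero_mem' := ⟨0, fun i => by simp⟩
  smul_mem' := by
    rintro m x ⟨z, hx⟩
    refine ⟨m • z, fun i => ?_⟩
    have hs : (m • x) i = (m : ℝ) * x i := by simp
    rw [hs, hx i]
    simp
    ring

/-- The theta series `Θ_Λ(iτ) = ∑_{λ ∈ Λ} exp(-π τ ‖λ‖²)` on the imaginary axis. -/
def theta {n : ℕ} (L : Submodule ℤ (EuclideanSpace ℝ (Fin n))) (τ : ℝ) : ℝ :=
  ∑' v : L, Real.exp (-π * τ * ‖(v : EuclideanSpace ℝ (Fin n))‖ ^ 2)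

/-- The Jacobi theta function `ϑ₃(iτ) = ∑_{v ∈ ℤ} exp(-π τ v²)` on the imaginary axis. -/
def theta3 (τ : ℝ) : ℝ := ∑' v : ℤ, Real.exp (-π * τ * (v : ℝ) ^ 2)

/-- `theta3 τ` is the value at `iτ` of the Jacobi theta function of Mathlib. -/
theorem theta3_eq_jacobiTheta (τ : ℝ) : (theta3 τ : ℂ) = jacobiTheta (Complex.I * τ) := by
  unfold theta3 jacobiTheta
  rw [Complex.ofReal_tsum]
  refine tsum_congr fun v => ?_
  push_cast
  congr 1
  linear_combination (-(π : ℂ) * τ * (v : ℂ) ^ 2) * Complex.I_mul_I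

/-- The theta series ratio `Δ_Λ(τ) = Θ_Λ(iτ) / Θ_{υℤⁿ}(iτ)`, where `vol Λ = υ ^ n`. -/
def thetaRatio {n : ℕ} (L : Submodule ℤ (EuclideanSpace ℝ (Fin n))) (τ : ℝ) : ℝ :=
  theta L τ / theta (scaledInt n (ZLattice.covolume L ^ (1 / (n : ℝ)))) τ

end SelfDualTheta

end

/-! Write A and B for the Gaussian sums over 2ℤ/√2 and (1 + 2ℤ)/√2. Splitting Construction A into
cosets gives Θ = W_C(A, B), and rotating ℤ² by 45° gives ϑ₃² = A² + B². Hence (A, B) =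
(ϑ₃/√2)(√(1+t), √(1-t)) with t = (A² - B²)/(A² + B²) in [0,1], and by homogeneity Θ = ϑ₃ⁿ f_C(t)/2^k
(`theta_constrA_eq`). As the covolume is 1, the theta series ratio is f_C(t)/2^k.

For a U-shaped f_C the maximum is at an end point, where f_C = 2^k, and the unique minimum is at
1/√2, where h = 3/4. This gives both bounds. Uniqueness of the minimum in τ needs t = 1/√2 only at τ
= 1, equivalently B/A = √2 - 1 only there (`cosetRatio_eq_iff`). Poisson summation yields the value
at 1 and reduces τ < 1 to τ > 1; an elementary comparison of decay rates settles τ > 1.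

The expansion in h comes from two symmetries of f_C: swapping the arguments of W_C is t ↦ -t, and
MacWilliams is t² ↦ 1 - t². An even polynomial in t that is also invariant under the second is a
polynomial in t²(1 - t²) = 1 - h (`exists_poly_hPoly`). -/

noncomputable section

namespace SelfDualTheta

section Codes

/-! ### Polynomials invariant under a reflection -/

open Polynomial in
/-- A polynomial with `P(c - x) = P(x)` is a polynomial in `x (c - x)`. -/
theorem exists_comp_of_comp_sub_eq {K : Type*} [Field K] [CharZero K] (c : K) :
    ∀ (m : ℕ) (P : K[X]), P.natDegree ≤ m → P.comp (C c - X) = P →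
      ∃ Q : K[X], P = Q.comp (X * (C c - X)) ∧ 2 * Q.natDegree ≤ P.natDegree := by
  intro m
  induction m using Nat.strong_induction_on with
  | _ m ih =>
    intro P hm hP
    obtain ⟨R, hR⟩ : X ∣ P - C (P.eval 0) := by
      rw [X_dvd_iff, coeff_zero_eq_eval_zero]
      simp
    have hR' : (C c - X) * R.comp (C c - X) = X * R := by
      rw [← hR]
      have := congrArg (fun p => p.comp (C c - X)) hR
      simp only [sub_comp, mul_comp, X_comp, C_comp] at this
      rw [hP] at this
      exact this.symm
    have hRc : R.eval c = 0 := by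
      -- For `c = 0` the two factors agree up to sign, so a double root is needed: cancelling `X`
      -- shows that `R` is odd, hence vanishes at 0.
      rcases eq_or_ne c 0 with rfl | hc
      · have h : X * (R.comp (-X) + R) = 0 := by
          have : (-X) * R.comp (-X) = X * R := by simpa using hR'
          linear_combination -this
        have h' := (mul_eq_zero.1 h).resolve_left X_ne_zero
        have h2 := congrArg (eval 0) h'
        simp only [eval_add, eval_comp, eval_neg, eval_X, neg_zero, eval_zero] at h2
        exact self_eq_neg.1 (eq_neg_of_add_eq_zero_left h2)
      · have h2 := congrArg (eval 0) hR'
        simpa [eval_comp, hc] using h2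
    obtain ⟨S, hS⟩ : C c - X ∣ R := by
      rw [← neg_sub, neg_dvd]
      exact dvd_iff_isRoot.2 hRc
    have hcX : (C c - X : K[X]) ≠ 0 := by
      rw [← neg_sub]
      exact neg_ne_zero.2 (X_sub_C_ne_zero c)
    have hcd : (C c - X : K[X]).natDegree = 1 := by
      rw [← neg_sub, natDegree_neg, natDegree_X_sub_C]
    have hSc : S.comp (C c - X) = S := by
      rw [hS] at hR'
      simp only [mul_comp, sub_comp, C_comp, X_comp, sub_sub_cancel] at hR'
      refine mul_left_cancel₀ (mul_ne_zero hcX X_ne_zero) ?_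
      linear_combination hR'
    have hPS : P = C (P.eval 0) + X * ((C c - X) * S) := by
      rw [← hS, ← hR]
      ring
    rcases eq_or_ne S 0 with h0 | h0
    · refine ⟨C (P.eval 0), ?_, by simp⟩
      conv_lhs => rw [hPS]
      simp [h0]
    · have hdeg : P.natDegree = S.natDegree + 2 := by
        rw [← natDegree_sub_C (a := P.eval 0), hR, hS,
          natDegree_mul X_ne_zero (mul_ne_zero hcX h0), natDegree_mul hcX h0, natDegree_X, hcd]
        ring
      obtain ⟨Q, hQ, hQd⟩ := ih S.natDegree (by omega) S le_rfl hSc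
      refine ⟨C (P.eval 0) + X * Q, ?_, ?_⟩
      · simp only [add_comp, C_comp, mul_comp, X_comp]
        rw [← hQ]
        conv_lhs => rw [hPS]
        ring
      · have h1 : (C (P.eval 0) + X * Q).natDegree ≤ 1 + Q.natDegree := by
          refine (natDegree_add_le _ _).trans (max_le (by simp) ?_)
          exact natDegree_mul_le.trans (by simp)
        omega

open Polynomial in
theorem eq_of_aeval_eq_on_infinite {p q : ℚ[X]} {s : Set ℝ} (hs : s.Infinite)
    (h : ∀ t ∈ s, aeval t p = aeval t q) : p = q := by
  have hinj := Polynomial.map_injective (algebraMap ℚ ℝ) (algebraMap ℚ ℝ).injective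
  apply hinj
  refine Polynomial.eq_of_infinite_eval_eq _ _ (hs.mono fun t ht => ?_)
  simpa [aeval_def, eval_map] using h t ht

/-! ### The MacWilliams identity -/

/-- The nontrivial additive character of `ZMod 2`, with real values. -/
def sign (a : ZMod 2) : ℝ := if a = 0 then 1 else -1

theorem sign_add (a b : ZMod 2) : sign (a + b) = sign a * sign b := by
  have h (a : ZMod 2) : a = 0 ∨ a = 1 := by revert a; decide
  rcases h a with rfl | rfl <;> rcases h b with rfl | rfl <;>
    simp [sign, CharTwo.add_self_eq_zero]

theorem sign_sum {ι : Type*} (s : Finset ι) (f : ι → ZMod 2) :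
    sign (∑ i ∈ s, f i) = ∏ i ∈ s, sign (f i) := by
  classical
  induction s using Finset.induction_on with
  | empty => simp [sign]
  | insert a s ha ih => rw [Finset.sum_insert ha, Finset.prod_insert ha, sign_add, ih]

theorem zmod_two_eq_one {a : ZMod 2} (h : a ≠ 0) : a = 1 := by
  revert h; revert a; decide

variable {n : ℕ} (C : Submodule (ZMod 2) (Fin n → ZMod 2))

theorem pow_mul_pow_hammingNorm (c : Fin n → ZMod 2) (x y : ℝ) :
    x ^ (n - hammingNorm c) * y ^ hammingNorm c = ∏ i, if c i = 0 then x else y := by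
  rw [Finset.prod_ite, Finset.prod_const, Finset.prod_const]
  have h := Finset.card_filter_add_card_filter_not (s := (Finset.univ : Finset (Fin n)))
    (fun i => c i = 0)
  rw [Finset.card_univ, Fintype.card_fin] at h
  have h' : hammingNorm c = (Finset.univ.filter fun i => ¬ c i = 0).card := rfl
  rw [h', Nat.sub_eq_of_eq_add h.symm]

open Classical in
theorem weightEnumerator_eq_sum (x y : ℝ) :
    weightEnumerator C x y = ∑ c : C, x ^ (n - hammingNorm c.1) * y ^ hammingNorm c.1 := by
  unfold weightEnumerator
  exact Finset.sum_subtype _ (by simp) _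

open Classical in
theorem weightEnumerator_eq_sum_prod (x y : ℝ) :
    weightEnumerator C x y = ∑ c : C, ∏ i, if c.1 i = 0 then x else y := by
  rw [weightEnumerator_eq_sum]
  exact Finset.sum_congr rfl fun c _ => pow_mul_pow_hammingNorm _ _ _

-- Orthogonality of characters: if `v` pairs to 1 with some codeword, translation by that codeword
-- negates the sum.
open Classical in
theorem sum_sign_dotProduct (v : Fin n → ZMod 2) :
    ∑ c : C, sign (v ⬝ᵥ c.1) = if v ∈ dualCode C then (Fintype.card C : ℝ) else 0 := by
  split_ifs with h
  · rw [Finset.sum_congr rfl (g := fun _ => (1 : ℝ))]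
    · simp
    · intro c _
      rw [h c.1 c.2]
      simp [sign]
  · obtain ⟨c, hc, hv⟩ : ∃ c ∈ C, v ⬝ᵥ c ≠ 0 := by
      by_contra! hcon
      exact h hcon
    have h1 : ∑ d : C, sign (v ⬝ᵥ d.1) = ∑ d : C, sign (v ⬝ᵥ (d + ⟨c, hc⟩ : C).1) :=
      (Equiv.sum_comp (Equiv.addRight (⟨c, hc⟩ : C)) fun d : C => sign (v ⬝ᵥ d.1)).symm
    have h2 : ∑ d : C, sign (v ⬝ᵥ (d + ⟨c, hc⟩ : C).1) = -∑ d : C, sign (v ⬝ᵥ d.1) := by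
      rw [← Finset.sum_neg_distrib]
      refine Finset.sum_congr rfl fun d _ => ?_
      rw [Submodule.coe_add, dotProduct_add, sign_add, zmod_two_eq_one hv]
      simp [sign]
    linarith

-- Each factor `x ± y` is a two-point Fourier transform. Expanding the product and exchanging sums
-- leaves character sums over the code, which select the dual.
open Classical in
theorem macWilliams (x y : ℝ) :
    weightEnumerator C (x + y) (x - y) =
      (Fintype.card C : ℝ) * weightEnumerator (dualCode C) x y := by
  have hprod (c : Fin n → ZMod 2) : (∏ i, if c i = 0 then x + y else x - y) =
      ∑ v : Fin n → ZMod 2, (∏ i, if v i = 0 then x else y) * sign (v ⬝ᵥ c) := by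
    have h (i : Fin n) : (if c i = 0 then x + y else x - y) =
        ∑ a : ZMod 2, (if a = 0 then x else y) * sign (a * c i) := by
      have hu : (Finset.univ : Finset (ZMod 2)) = {0, 1} := rfl
      rw [hu, Finset.sum_pair (by decide)]
      by_cases hc : c i = 0 <;> simp [hc, sign, sub_eq_add_neg]
    simp_rw [h]
    rw [Finset.prod_univ_sum, Fintype.piFinset_univ]
    refine Finset.sum_congr rfl fun v _ => ?_
    rw [Finset.prod_mul_distrib, dotProduct, sign_sum]
  rw [weightEnumerator_eq_sum_prod]
  simp_rw [hprod]
  rw [Finset.sum_comm]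
  simp_rw [← Finset.mul_sum, sum_sign_dotProduct]
  unfold weightEnumerator
  rw [Finset.mul_sum, Finset.sum_filter]
  refine Finset.sum_congr rfl fun v _ => ?_
  rw [pow_mul_pow_hammingNorm]
  split_ifs <;> ring

/-! ### Self-dual codes -/

variable {C}

open Classical in
theorem card_code : (Fintype.card C : ℝ) = 2 ^ Module.finrank (ZMod 2) C := by
  rw [Module.card_eq_pow_finrank (K := ZMod 2), ZMod.card]
  norm_cast

theorem weightEnumerator_one_zero : weightEnumerator C 1 0 = 1 := by
  classical
  rw [weightEnumerator_eq_sum, Fintype.sum_eq_single 0]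
  · simp
  · intro c hc
    have : hammingNorm c.1 ≠ 0 := by simpa using hc
    simp [this]

theorem weightEnumerator_mul (a x y : ℝ) :
    weightEnumerator C (a * x) (a * y) = a ^ n * weightEnumerator C x y := by
  unfold weightEnumerator
  rw [Finset.mul_sum]
  refine Finset.sum_congr rfl fun c _ => ?_
  have h : hammingNorm c ≤ n := by simpa using hammingNorm_le_card_fintype (x := c)
  rw [mul_pow, mul_pow, mul_mul_mul_comm, ← pow_add, Nat.sub_add_cancel h]

theorem weightEnumerator_one_one :
    weightEnumerator C 1 1 = 2 ^ Module.finrank (ZMod 2) C := by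
  classical
  rw [weightEnumerator_eq_sum, ← card_code]
  simp

theorem macWilliams_selfDual (hC : IsSelfDual C) (x y : ℝ) :
    weightEnumerator C (x + y) (x - y) =
      2 ^ Module.finrank (ZMod 2) C * weightEnumerator C x y := by
  rw [macWilliams, card_code, ← hC]

/-- MacWilliams at (1, 1) compares W(2, 0) = 2ⁿ with 2^k · 2^k. -/
theorem length_eq (hC : IsSelfDual C) : n = 2 * Module.finrank (ZMod 2) C := by
  have h := macWilliams_selfDual hC 1 1
  rw [weightEnumerator_one_one, sub_self] at h
  have h' := weightEnumerator_mul (C := C) 2 1 0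
  rw [weightEnumerator_one_zero, mul_zero, mul_one, mul_one] at h'
  rw [one_add_one_eq_two, h', ← pow_add, ← two_mul] at h
  exact pow_right_injective₀ (by norm_num) (by norm_num) h

theorem even_hammingNorm (hC : IsSelfDual C) {c : Fin n → ZMod 2} (hc : c ∈ C) :
    Even (hammingNorm c) := by
  have h : c ⬝ᵥ c = 0 := by
    have hc' := hc
    rw [hC] at hc'
    exact hc' c hc
  have h1 : c ⬝ᵥ c = (hammingNorm c : ZMod 2) := by
    have : hammingNorm c = (Finset.univ.filter fun i => c i ≠ 0).card := rfl
    rw [this, Finset.card_filter, Nat.cast_sum, dotProduct]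
    refine Finset.sum_congr rfl fun i _ => ?_
    by_cases hi : c i = 0
    · simp [hi]
    · simp [zmod_two_eq_one hi]
  rw [h1, ZMod.natCast_eq_zero_iff_even] at h
  exact h

theorem weightEnumerator_neg_right (hC : IsSelfDual C) (x y : ℝ) :
    weightEnumerator C x (-y) = weightEnumerator C x y := by
  classical
  rw [weightEnumerator_eq_sum, weightEnumerator_eq_sum]
  exact Finset.sum_congr rfl fun c _ => by rw [(even_hammingNorm hC c.2).neg_pow]

/-- By even weights, negating the second argument changes nothing; on the other side of MacWilliams
it exchanges `x + y` and `x - y`. -/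
theorem weightEnumerator_swap (hC : IsSelfDual C) (x y : ℝ) :
    weightEnumerator C x y = weightEnumerator C y x := by
  have h1 := macWilliams_selfDual hC ((x + y) / 2) ((x - y) / 2)
  have h2 := macWilliams_selfDual hC ((x + y) / 2) (-((x - y) / 2))
  rw [weightEnumerator_neg_right hC, ← h1] at h2
  ring_nf at h2
  exact h2.symm

open Polynomial in
open Classical in
/-- `f_C` as a polynomial. -/
def codePoly (C : Submodule (ZMod 2) (Fin n → ZMod 2)) : ℚ[X] :=
  ∑ c : C, (1 + X) ^ (Module.finrank (ZMod 2) C - hammingNorm c.1 / 2) *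
    (1 - X) ^ (hammingNorm c.1 / 2)

theorem natDegree_codePoly_le (hC : IsSelfDual C) : (codePoly C).natDegree ≤ n / 2 := by
  classical
  unfold codePoly
  refine Polynomial.natDegree_sum_le_of_forall_le _ _ fun c _ => ?_
  have h : hammingNorm c.1 ≤ n := by simpa using hammingNorm_le_card_fintype (x := c.1)
  have hn := length_eq hC
  set k := Module.finrank (ZMod 2) C
  have h1 : (1 + Polynomial.X : Polynomial ℚ).natDegree ≤ 1 := by compute_degree
  have h2 : (1 - Polynomial.X : Polynomial ℚ).natDegree ≤ 1 := by compute_degree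
  have h3 := Polynomial.natDegree_pow_le_of_le (k - hammingNorm c.1 / 2) h1
  have h4 := Polynomial.natDegree_pow_le_of_le (hammingNorm c.1 / 2) h2
  refine (Polynomial.natDegree_mul_le_of_le h3 h4).trans ?_
  omega

/-- Length and weights are even, so only even powers of the square roots occur. -/
theorem weightEnumerator_sqrt (hC : IsSelfDual C) {t : ℝ} (h0 : 0 ≤ 1 + t) (h1 : 0 ≤ 1 - t) :
    weightEnumerator C (√(1 + t)) (√(1 - t)) = Polynomial.aeval t (codePoly C) := by
  classical
  rw [weightEnumerator_eq_sum, codePoly, map_sum]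
  refine Finset.sum_congr rfl fun c _ => ?_
  obtain ⟨m, hm⟩ := even_hammingNorm hC c.2
  have hn := length_eq hC
  set k := Module.finrank (ZMod 2) C
  have e1 : n - hammingNorm c.1 = 2 * (k - hammingNorm c.1 / 2) := by omega
  have e2 : hammingNorm c.1 = 2 * (hammingNorm c.1 / 2) := by omega
  rw [e1]
  nth_rw 2 [e2]
  rw [pow_mul, pow_mul, Real.sq_sqrt h0, Real.sq_sqrt h1]
  simp

theorem codeFun_eq_aeval (hC : IsSelfDual C) {t : ℝ} (ht : t ∈ Set.Icc (0 : ℝ) 1) :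
    codeFun C t = Polynomial.aeval t (codePoly C) :=
  weightEnumerator_sqrt hC (by linarith [ht.1]) (by linarith [ht.2])

theorem aeval_codePoly_neg (hC : IsSelfDual C) {t : ℝ} (ht : t ∈ Set.Icc (0 : ℝ) 1) :
    Polynomial.aeval (-t) (codePoly C) = Polynomial.aeval t (codePoly C) := by
  obtain ⟨h0, h1⟩ := ht
  rw [← weightEnumerator_sqrt hC (t := -t) (by linarith) (by linarith),
    ← weightEnumerator_sqrt hC (t := t) (by linarith) (by linarith),
    weightEnumerator_swap hC, sub_neg_eq_add, sub_eq_add_neg]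

/-- With x = √(1+t), y = √(1-t) and s = √(1-t²), one has (x ± y)² = 2(1 ± s). So MacWilliams relates
the values at s and t, and its factor 2^k cancels the factor √2ⁿ from homogeneity. -/
theorem aeval_codePoly_sqrt (hC : IsSelfDual C) {t : ℝ} (ht : t ∈ Set.Icc (0 : ℝ) 1) :
    Polynomial.aeval (√(1 - t ^ 2)) (codePoly C) = Polynomial.aeval t (codePoly C) := by
  obtain ⟨h0, h1⟩ := ht
  have hs : 0 ≤ 1 - t ^ 2 := by nlinarith
  set s := √(1 - t ^ 2) with hsdef
  have hs0 : 0 ≤ s := Real.sqrt_nonneg _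
  have hs2 : s ^ 2 = 1 - t ^ 2 := Real.sq_sqrt hs
  have hs1 : s ≤ 1 := by nlinarith
  rw [← weightEnumerator_sqrt hC (by linarith) (by linarith),
    ← weightEnumerator_sqrt hC (by linarith) (by linarith)]
  set x := √(1 + t)
  set y := √(1 - t)
  have hx0 : 0 ≤ x := Real.sqrt_nonneg _
  have hy0 : 0 ≤ y := Real.sqrt_nonneg _
  have hx : x ^ 2 = 1 + t := Real.sq_sqrt (by linarith)
  have hy : y ^ 2 = 1 - t := Real.sq_sqrt (by linarith)
  have hyx : y ≤ x := Real.sqrt_le_sqrt (by linarith)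
  have hxy : x * y = s := by
    rw [hsdef, ← Real.sqrt_mul (by linarith)]
    congr 1
    ring
  have h2 : √2 ^ 2 = 2 := Real.sq_sqrt (by norm_num)
  have h20 : 0 < √2 := Real.sqrt_pos.2 (by norm_num)
  have ex : √2 * √(1 + s) = x + y := by
    rw [← Real.sqrt_mul (by norm_num), ← Real.sqrt_sq (add_nonneg hx0 hy0)]
    congr 1
    linarith [add_sq x y]
  have ey : √2 * √(1 - s) = x - y := by
    rw [← Real.sqrt_mul (by norm_num), ← Real.sqrt_sq (sub_nonneg.2 hyx)]
    congr 1
    linarith [sub_sq x y]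
  have hm := macWilliams_selfDual hC x y
  rw [← ex, ← ey, weightEnumerator_mul] at hm
  have hn := length_eq hC
  have hp : √2 ^ n = 2 ^ Module.finrank (ZMod 2) C := by
    conv_lhs => rw [hn]
    rw [pow_mul, h2]
  rw [hp] at hm
  exact mul_left_cancel₀ (by positivity) hm

/-! ### The polynomial in `h` -/

open Polynomial in
theorem exists_poly_hPoly (hC : IsSelfDual C) :
    ∃ K : ℚ[X], K.natDegree ≤ n / 8 ∧
      ∀ t ∈ Set.Icc (0 : ℝ) 1, codeFun C t = aeval (hPoly t) K := by
  have hinf : (Set.Icc (0 : ℝ) 1).Infinite := Set.Icc_infinite one_pos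
  have heven : (codePoly C).comp (Polynomial.C 0 - X) = codePoly C := by
    refine eq_of_aeval_eq_on_infinite hinf fun t ht => ?_
    rw [aeval_comp, map_zero, zero_sub, map_neg, aeval_X, aeval_codePoly_neg hC ht]
  -- In the variable u = -t² = t(0 - t) the remaining symmetry t² ↦ 1 - t² is u ↦ -1 - u.
  obtain ⟨G, hG, hGd⟩ := exists_comp_of_comp_sub_eq 0 _ _ le_rfl heven
  have hGe (t : ℝ) : aeval t (codePoly C) = aeval (-t ^ 2) G := by
    conv_lhs => rw [hG]
    rw [aeval_comp]
    congr 2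
    simp
    ring
  have hGs : G.comp (Polynomial.C (-1) - X) = G := by
    refine eq_of_aeval_eq_on_infinite
      (s := Set.Icc (-1) 0) (Set.Icc_infinite (by norm_num)) fun s hs => ?_
    have h1 : √(-s) ^ 2 = -s := Real.sq_sqrt (by linarith [hs.2])
    have h0 : √(-s) ∈ Set.Icc (0 : ℝ) 1 := ⟨Real.sqrt_nonneg _, by
      exact Real.sqrt_le_one.2 (by linarith [hs.1])⟩
    have h2 := aeval_codePoly_sqrt hC h0
    rw [hGe, hGe, Real.sq_sqrt (by rw [h1]; linarith [hs.1]), h1, neg_neg] at h2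
    rw [aeval_comp, ← h2]
    congr 2
    simp
    ring
  obtain ⟨H, hH, hHd⟩ := exists_comp_of_comp_sub_eq (-1) _ _ le_rfl hGs
  -- Here u(-1 - u) = t² - t⁴ = 1 - h(t). The degree was at most n/2 and has been halved twice.
  refine ⟨H.comp (1 - X), ?_, fun t ht => ?_⟩
  · have h1 : (1 - X : ℚ[X]).natDegree ≤ 1 := by compute_degree
    have h2 := natDegree_comp_le (p := H) (q := 1 - X)
    have h3 := Nat.mul_le_mul_left H.natDegree h1
    have h4 := natDegree_codePoly_le hC
    omega
  · rw [codeFun_eq_aeval hC ht, hGe]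
    conv_lhs => rw [hH]
    rw [aeval_comp, aeval_comp]
    congr 2
    simp [hPoly]
    ring

theorem exists_isCoeff (hC : IsSelfDual C) : ∃ a : Fin (n / 8 + 1) → ℚ, IsCoeff C a := by
  obtain ⟨K, hK, h⟩ := exists_poly_hPoly hC
  refine ⟨fun r => K.coeff r / 2 ^ Module.finrank (ZMod 2) C, fun t ht => ?_⟩
  rw [h t ht, Polynomial.aeval_eq_sum_range' (Nat.lt_succ_of_le hK), Finset.sum_range,
    Finset.mul_sum]
  refine Finset.sum_congr rfl fun r _ => ?_
  push_cast
  rw [Algebra.smul_def, eq_ratCast]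
  field_simp

theorem infinite_image_hPoly : (hPoly '' Set.Icc (0 : ℝ) 1).Infinite := by
  have hc : ContinuousOn hPoly (Set.Icc (0 : ℝ) (1 / 2)) := by
    unfold hPoly
    fun_prop
  refine ((Set.Icc_infinite (a := hPoly (1 / 2)) (b := hPoly 0) (by norm_num [hPoly])).mono
    (intermediate_value_Icc' (by norm_num) hc)).mono ?_
  exact Set.image_mono (Set.Icc_subset_Icc_right (by norm_num))

open Polynomial in
theorem isCoeff_unique {a b : Fin (n / 8 + 1) → ℚ} (ha : IsCoeff C a) (hb : IsCoeff C b) :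
    b = a := by
  have hpoly (d : Fin (n / 8 + 1) → ℚ) (x : ℝ) :
      aeval x (∑ r : Fin (n / 8 + 1), monomial (r : ℕ) (d r)) = ∑ r, (d r : ℝ) * x ^ (r : ℕ) := by
    simp [aeval_monomial]
  have h : (∑ r : Fin (n / 8 + 1), monomial (r : ℕ) (b r) : ℚ[X]) = ∑ r : Fin (n / 8 + 1), monomial (r : ℕ) (a r) := by
    refine eq_of_aeval_eq_on_infinite infinite_image_hPoly ?_
    rintro _ ⟨t, ht, rfl⟩
    rw [hpoly, hpoly]
    exact mul_left_cancel₀ (by positivity) ((hb t ht).symm.trans (ha t ht))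
  ext r
  have hr := congrArg (fun p => coeff p (r : ℕ)) h
  simpa [finsetSum_coeff, coeff_monomial, Fin.val_inj] using hr

theorem codeFun_zero : codeFun C 0 = 2 ^ Module.finrank (ZMod 2) C := by
  simp [codeFun, weightEnumerator_one_one]

theorem codeFun_one (hC : IsSelfDual C) : codeFun C 1 = 2 ^ Module.finrank (ZMod 2) C := by
  have h2 : √2 ^ 2 = 2 := Real.sq_sqrt (by norm_num)
  have h := weightEnumerator_mul (C := C) (√2) 1 0
  rw [weightEnumerator_one_zero, mul_one, mul_one, mul_zero] at h
  rw [codeFun, sub_self, Real.sqrt_zero, one_add_one_eq_two, h]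
  conv_lhs => rw [length_eq hC]
  rw [pow_mul, h2]

theorem sum_eq_one_of_isCoeff {a : Fin (n / 8 + 1) → ℚ} (ha : IsCoeff C a) : ∑ r, a r = 1 := by
  have h := ha 0 (by simp)
  rw [codeFun_zero] at h
  have h' : ∑ r, (a r : ℝ) = 1 := by
    have : (2 : ℝ) ^ Module.finrank (ZMod 2) C ≠ 0 := by positivity
    simpa [hPoly, this] using h
  exact_mod_cast h'

end Codes

section Theta

/-! ### Sums of Gaussians -/

theorem summable_theta3 {τ : ℝ} (hτ : 0 < τ) :
    Summable fun v : ℤ => Real.exp (-π * τ * (v : ℝ) ^ 2) := by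
  have him : 0 < (Complex.I * τ).im := by simpa
  have h := (summable_jacobiTheta₂_term_iff 0 (Complex.I * τ)).2 him
  refine h.norm.congr fun v => ?_
  rw [norm_jacobiTheta₂_term]
  simp
  ring_nf

theorem hasSum_theta3 {τ : ℝ} (hτ : 0 < τ) :
    HasSum (fun v : ℤ => Real.exp (-π * τ * (v : ℝ) ^ 2)) (theta3 τ) :=
  (summable_theta3 hτ).hasSum

theorem theta3_pos {τ : ℝ} (hτ : 0 < τ) : 0 < theta3 τ :=
  (summable_theta3 hτ).tsum_pos (fun _ => (Real.exp_pos _).le) 0 (Real.exp_pos _)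

/-- The Gaussian sum over the coset `(a + 2 ℤ) / √2`. -/
def thetaCoset (a : ZMod 2) (τ : ℝ) : ℝ :=
  ∑' z : ℤ, Real.exp (-π * τ * (((a.val : ℝ) + 2 * z) ^ 2 / 2))

theorem hasSum_thetaCoset (a : ZMod 2) {τ : ℝ} (hτ : 0 < τ) :
    HasSum (fun z : ℤ => Real.exp (-π * τ * (((a.val : ℝ) + 2 * z) ^ 2 / 2)))
      (thetaCoset a τ) := by
  have h : Function.Injective fun z : ℤ => (a.val : ℤ) + 2 * z := fun x y hxy => by
    simp only at hxy
    omega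
  refine Summable.hasSum (((summable_theta3 (half_pos hτ)).comp_injective h).congr fun z => ?_)
  simp only [Function.comp_apply]
  push_cast
  congr 1
  ring

theorem thetaCoset_pos (a : ZMod 2) {τ : ℝ} (hτ : 0 < τ) : 0 < thetaCoset a τ :=
  (hasSum_thetaCoset a hτ).summable.tsum_pos (fun _ => (Real.exp_pos _).le) 0 (Real.exp_pos _)

theorem thetaCoset_zero_eq (τ : ℝ) : thetaCoset 0 τ = theta3 (2 * τ) := by
  unfold thetaCoset theta3
  refine tsum_congr fun z => ?_
  simp
  ring

theorem hasSum_mul_of_nonneg {ι κ : Type*} {f : ι → ℝ} {g : κ → ℝ} {s t : ℝ} (hf : HasSum f s)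
    (hg : HasSum g t) (hf0 : 0 ≤ f) (hg0 : 0 ≤ g) :
    HasSum (fun p : ι × κ => f p.1 * g p.2) (s * t) :=
  hf.mul hg (hf.summable.mul_of_nonneg hg.summable hf0 hg0)

theorem hasSum_pi_prod {n : ℕ} {α : Type*} (f : Fin n → α → ℝ) (s : Fin n → ℝ)
    (hf0 : ∀ i, 0 ≤ f i) (hf : ∀ i, HasSum (f i) (s i)) :
    HasSum (fun z : Fin n → α => ∏ i, f i (z i)) (∏ i, s i) := by
  induction n with
  | zero => simp
  | succ n ih =>
    have h := hasSum_mul_of_nonneg (hf 0) (ih (fun i => f i.succ) (fun i => s i.succ)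
      (fun i => hf0 _) fun i => hf _) (hf0 0)
      fun z => Finset.prod_nonneg fun i _ => hf0 i.succ (z i)
    rw [Fin.prod_univ_succ, ← (Fin.consEquiv fun _ => α).hasSum_iff]
    refine h.congr_fun ?_
    intro p
    simp [Fin.prod_univ_succ, Fin.consEquiv]

/-- The pairs of integers, by parity of the sum, in the rotated coordinates. -/
def pairEquiv : (ℤ × ℤ) ⊕ (ℤ × ℤ) ≃ ℤ × ℤ where
  toFun := Sum.elim (fun p => (p.1 + p.2, p.1 - p.2)) (fun p => (p.1 + p.2 + 1, p.1 - p.2))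
  invFun p := if (p.1 + p.2) % 2 = 0 then Sum.inl ((p.1 + p.2) / 2, (p.1 - p.2) / 2)
    else Sum.inr ((p.1 + p.2) / 2, (p.1 - p.2) / 2)
  left_inv := by
    rintro (⟨u, v⟩ | ⟨u, v⟩)
    · have h : (u + v + (u - v)) % 2 = 0 := by omega
      simp only [Sum.elim_inl, h, if_true]
      congr 2 <;> omega
    · have h : ¬ (u + v + 1 + (u - v)) % 2 = 0 := by omega
      simp only [Sum.elim_inr, h, if_false]
      congr 2 <;> omega
  right_inv := by
    rintro ⟨a, b⟩
    by_cases h : (a + b) % 2 = 0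
    · simp only [h, if_true, Sum.elim_inl]
      congr 1 <;> omega
    · simp only [h, if_false, Sum.elim_inr]
      congr 1 <;> omega

/-- Rotation of ℤ² by 45°: pairs with even sum become pairs from the even coset, those with odd sum
pairs from the odd coset. -/
theorem theta3_sq {τ : ℝ} (hτ : 0 < τ) :
    theta3 τ ^ 2 = thetaCoset 0 τ ^ 2 + thetaCoset 1 τ ^ 2 := by
  have hsq {f : ℤ → ℝ} {s : ℝ} (h : HasSum (fun z => Real.exp (f z)) s) :
      HasSum (fun p : ℤ × ℤ => Real.exp (f p.1 + f p.2)) (s ^ 2) := by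
    simp only [Real.exp_add, sq]
    exact hasSum_mul_of_nonneg h h (fun _ => (Real.exp_pos _).le) (fun _ => (Real.exp_pos _).le)
  have h3 := hsq (hasSum_theta3 hτ)
  rw [← pairEquiv.hasSum_iff] at h3
  refine h3.unique (HasSum.sum ?_ ?_)
  · refine (hsq (hasSum_thetaCoset 0 hτ)).congr_fun fun p => ?_
    simp [pairEquiv]
    ring
  · refine (hsq (hasSum_thetaCoset 1 hτ)).congr_fun fun p => ?_
    simp [pairEquiv, ZMod.val_one]
    ring

/-! ### Theta series of the lattices -/

theorem theta_scaledInt_one {n : ℕ} {τ : ℝ} (hτ : 0 < τ) :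
    theta (scaledInt n 1) τ = theta3 τ ^ n := by
  have h := hasSum_pi_prod (n := n) (fun _ v => Real.exp (-π * τ * ((v : ℤ) : ℝ) ^ 2))
    (fun _ => theta3 τ) (fun _ _ => (Real.exp_pos _).le) fun _ => hasSum_theta3 hτ
  rw [Finset.prod_const, Finset.card_univ, Fintype.card_fin] at h
  let e : (Fin n → ℤ) → scaledInt n 1 := fun z =>
    ⟨WithLp.toLp 2 fun i => (z i : ℝ), z, fun i => by simp⟩
  have he : Function.Bijective e := by
    constructor
    · intro z w h
      ext i
      have := congrArg (fun x : scaledInt n 1 => x.1 i) h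
      simpa [e] using this
    · rintro ⟨x, z, hz⟩
      refine ⟨z, Subtype.ext ?_⟩
      ext i
      simp [e, hz i]
  rw [theta, ← h.tsum_eq, ← (Equiv.ofBijective e he).tsum_eq]
  refine tsum_congr fun z => ?_
  rw [← Real.exp_sum, ← Finset.mul_sum, EuclideanSpace.real_norm_sq_eq]
  simp [e]

/-- The lattice is the disjoint union, over codewords, of products of one-dimensional cosets, and
the Gaussian factors over coordinates. -/
theorem theta_constrA {n : ℕ} (C : Submodule (ZMod 2) (Fin n → ZMod 2)) {τ : ℝ} (hτ : 0 < τ) :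
    theta (constrA C) τ = weightEnumerator C (thetaCoset 0 τ) (thetaCoset 1 τ) := by
  classical
  have h (c : C) := hasSum_pi_prod
    (fun i z => Real.exp (-π * τ * ((((c.1 i).val : ℝ) + 2 * (z : ℤ)) ^ 2 / 2)))
    (fun i => thetaCoset (c.1 i) τ) (fun _ _ => (Real.exp_pos _).le)
    fun i => hasSum_thetaCoset (c.1 i) hτ
  let e : C × (Fin n → ℤ) → constrA C := fun p =>
    ⟨WithLp.toLp 2 fun i => (1 / √2) * (((p.1.1 i).val : ℝ) + 2 * (p.2 i : ℝ)),
      p.1.1, p.1.2, p.2, fun i => rfl⟩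
  have h2 : (1 / √2) ^ 2 = 1 / 2 := by
    rw [div_pow, Real.sq_sqrt (by norm_num), one_pow]
  have h20 : 1 / √2 ≠ 0 := by positivity
  have he : Function.Bijective e := by
    constructor
    · rintro ⟨c, z⟩ ⟨d, w⟩ h
      have key (i : Fin n) : ((c.1 i).val : ℤ) + 2 * z i = ((d.1 i).val : ℤ) + 2 * w i := by
        have := congrArg (fun x : constrA C => x.1 i) h
        have : ((c.1 i).val : ℝ) + 2 * (z i : ℝ) = ((d.1 i).val : ℝ) + 2 * (w i : ℝ) :=
          mul_left_cancel₀ h20 this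
        exact_mod_cast this
      have hcd (i : Fin n) : (c.1 i).val = (d.1 i).val ∧ z i = w i := by
        have h1 := key i
        have h2 := ZMod.val_lt (c.1 i)
        have h3 := ZMod.val_lt (d.1 i)
        omega
      refine Prod.ext (Subtype.ext (funext fun i => ZMod.val_injective 2 (hcd i).1))
        (funext fun i => (hcd i).2)
    · rintro ⟨x, c, hc, z, hz⟩
      refine ⟨(⟨c, hc⟩, z), Subtype.ext ?_⟩
      ext i
      exact (hz i).symm
  rw [theta, ← (Equiv.ofBijective e he).tsum_eq]
  have hterm (p : C × (Fin n → ℤ)) :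
      Real.exp (-π * τ * ‖((Equiv.ofBijective e he p : constrA C) :
        EuclideanSpace ℝ (Fin n))‖ ^ 2) =
      ∏ i, Real.exp (-π * τ * ((((p.1.1 i).val : ℝ) + 2 * (p.2 i : ℤ)) ^ 2 / 2)) := by
    rw [← Real.exp_sum, ← Finset.mul_sum, EuclideanSpace.real_norm_sq_eq]
    congr 2
    refine Finset.sum_congr rfl fun i _ => ?_
    simp only [e, Equiv.ofBijective_apply]
    rw [mul_pow, h2]
    ring
  simp_rw [hterm]
  rw [Summable.tsum_prod, tsum_fintype, weightEnumerator_eq_sum_prod]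
  · refine Finset.sum_congr rfl fun c _ => ?_
    rw [(h c).tsum_eq]
    refine Finset.prod_congr rfl fun i _ => ?_
    split_ifs with hi
    · rw [hi]
    · rw [zmod_two_eq_one hi]
  · rw [summable_prod_of_nonneg fun p => Finset.prod_nonneg fun i _ => (Real.exp_pos _).le]
    exact ⟨fun c => (h c).summable, Summable.of_finite⟩

end Theta

section Covolume

/-! ### Covolumes -/

/-- The basis of multiples of the standard basis vectors by a nonzero real number. -/
def scaledBasis (n : ℕ) {υ : ℝ} (hυ : υ ≠ 0) : Module.Basis (Fin n) ℝ (EuclideanSpace ℝ (Fin n)) :=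
  (EuclideanSpace.basisFun (Fin n) ℝ).toBasis.isUnitSMul fun _ => hυ.isUnit

theorem span_scaledBasis (n : ℕ) {υ : ℝ} (hυ : υ ≠ 0) :
    Submodule.span ℤ (Set.range (scaledBasis n hυ)) = scaledInt n υ := by
  have hb (i : Fin n) : scaledBasis n hυ i = υ • EuclideanSpace.single i (1 : ℝ) := by
    simp [scaledBasis, Module.Basis.isUnitSMul_apply]
  apply le_antisymm
  · rw [Submodule.span_le]
    rintro _ ⟨i, rfl⟩
    refine ⟨Pi.single i 1, fun j => ?_⟩
    rw [hb]
    by_cases hij : j = i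
    · subst hij; simp
    · simp [hij]
  · rintro x ⟨z, hz⟩
    have : x = ∑ i, z i • scaledBasis n hυ i := by
      ext j
      simp [hb, hz j, Pi.single_apply]
    rw [this]
    exact Submodule.sum_mem _ fun i _ => Submodule.smul_mem _ _ (Submodule.subset_span ⟨i, rfl⟩)

theorem discreteTopology_scaledInt (n : ℕ) {υ : ℝ} (hυ : υ ≠ 0) :
    DiscreteTopology (scaledInt n υ) := by
  rw [← span_scaledBasis n hυ]
  infer_instance

theorem span_scaledInt (n : ℕ) {υ : ℝ} (hυ : υ ≠ 0) :
    Submodule.span ℝ (scaledInt n υ : Set (EuclideanSpace ℝ (Fin n))) = ⊤ := by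
  rw [← span_scaledBasis n hυ]
  exact ZSpan.span_top _

theorem covolume_scaledInt (n : ℕ) {υ : ℝ} (hυ : 0 < υ) :
    ZLattice.covolume (scaledInt n υ) = υ ^ n := by
  rw [← span_scaledBasis n hυ.ne', ZLattice.covolume_eq_measure_fundamentalDomain _ _
    (ZSpan.isAddFundamentalDomain (scaledBasis n hυ.ne') MeasureTheory.volume),
    ZSpan.measureReal_fundamentalDomain _ _ (EuclideanSpace.basisFun (Fin n) ℝ).toBasis,
    MeasureTheory.measureReal_congr (ZSpan.fundamentalDomain_ae_parallelepiped _ _),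
    MeasureTheory.measureReal_def, OrthonormalBasis.coe_toBasis,
    OrthonormalBasis.volume_parallelepiped]
  have : ⇑(scaledBasis n hυ.ne') = fun i => υ • (EuclideanSpace.basisFun (Fin n) ℝ).toBasis i := by
    ext1 i
    simp [scaledBasis, Module.Basis.isUnitSMul_apply]
  rw [this, AlternatingMap.map_smul_univ, Module.Basis.det_self]
  simp [abs_of_pos (pow_pos hυ n)]

variable {n : ℕ} (C : Submodule (ZMod 2) (Fin n → ZMod 2))

theorem constrA_le : constrA C ≤ scaledInt n (1 / √2) := by
  rintro x ⟨c, -, z, hx⟩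
  exact ⟨fun i => (c i).val + 2 * z i, fun i => by rw [hx i]; push_cast; rfl⟩

theorem le_constrA : scaledInt n (√2) ≤ constrA C := by
  rintro x ⟨z, hx⟩
  refine ⟨0, C.zero_mem, z, fun i => ?_⟩
  have h : √2 ^ 2 = 2 := Real.sq_sqrt (by norm_num)
  have h0 : √2 ≠ 0 := by positivity
  rw [hx i]
  simp
  field_simp
  linear_combination (z i : ℝ) * h

theorem discreteTopology_constrA : DiscreteTopology (constrA C) := by
  have := discreteTopology_scaledInt n (υ := 1 / √2) (by positivity)
  exact DiscreteTopology.of_subset this (constrA_le C)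

theorem span_constrA :
    Submodule.span ℝ (constrA C : Set (EuclideanSpace ℝ (Fin n))) = ⊤ := by
  refine top_le_iff.1 ?_
  rw [← span_scaledInt n (υ := √2) (by positivity)]
  exact Submodule.span_mono (le_constrA C)

/-- The embedding `z ↦ υ z` of `ℤⁿ` into `ℝⁿ`. -/
def scaleHom (n : ℕ) (υ : ℝ) : (Fin n → ℤ) →+ EuclideanSpace ℝ (Fin n) where
  toFun z := WithLp.toLp 2 fun i => υ * (z i : ℝ)
  map_zero' := by ext i; simp
  map_add' z w := by ext i; simp [mul_add]

theorem scaleHom_injective (n : ℕ) {υ : ℝ} (hυ : υ ≠ 0) : Function.Injective (scaleHom n υ) := by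
  intro z w h
  ext i
  have := congrArg (fun x : EuclideanSpace ℝ (Fin n) => x i) h
  simpa [scaleHom, hυ] using this

/-- Coordinatewise reduction modulo `2`. -/
def reduction (n : ℕ) : (Fin n → ℤ) →+ (Fin n → ZMod 2) where
  toFun z i := z i
  map_zero' := by ext i; simp
  map_add' z w := by ext i; simp

theorem reduction_surjective (n : ℕ) : Function.Surjective (reduction n) := fun c =>
  ⟨fun i => (c i).val, by ext i; simp [reduction]⟩

theorem map_top_scaleHom (n : ℕ) (υ : ℝ) :
    (⊤ : AddSubgroup (Fin n → ℤ)).map (scaleHom n υ) = (scaledInt n υ).toAddSubgroup := by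
  ext x
  constructor
  · rintro ⟨z, -, rfl⟩
    exact ⟨z, fun i => rfl⟩
  · rintro ⟨z, hz⟩
    exact ⟨z, trivial, by ext i; exact (hz i).symm⟩

theorem map_comap_reduction :
    (C.toAddSubgroup.comap (reduction n)).map (scaleHom n (1 / √2)) =
      (constrA C).toAddSubgroup := by
  ext x
  constructor
  · rintro ⟨z, hz, rfl⟩
    refine ⟨reduction n z, hz, fun i => z i / 2, fun i => ?_⟩
    have h : z i = ((reduction n z i).val : ℤ) + 2 * (z i / 2) := by
      have : ((reduction n z i).val : ℤ) = z i % 2 := ZMod.val_intCast _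
      omega
    have h' : (z i : ℝ) = ((reduction n z i).val : ℝ) + 2 * ((z i / 2 : ℤ) : ℝ) := by
      exact_mod_cast h
    rw [← h']
    rfl
  · rintro ⟨c, hc, z, hz⟩
    refine ⟨fun i => (c i).val + 2 * z i, ?_, ?_⟩
    · have : reduction n (fun i => (c i).val + 2 * z i) = c := by
        ext i
        have h2 : (2 : ZMod 2) = 0 := rfl
        simp [reduction, h2]
      change reduction n _ ∈ C
      rwa [this]
    · ext i
      rw [hz i]
      simp [scaleHom]

variable {C}

/-- The index in (1/√2)ℤⁿ is that of the code in 𝔽₂ⁿ, namely 2^(n-k) = 2^k, while (1/√2)ℤⁿ has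
covolume 2^(-n/2) = 2^(-k). -/
theorem covolume_constrA (hC : IsSelfDual C) : ZLattice.covolume (constrA C) = 1 := by
  classical
  have h0 : 0 < 1 / √2 := by positivity
  have := discreteTopology_constrA C
  have := discreteTopology_scaledInt n h0.ne'
  have : IsZLattice ℝ (constrA C) := ⟨span_constrA C⟩
  have : IsZLattice ℝ (scaledInt n (1 / √2)) := ⟨span_scaledInt n h0.ne'⟩
  have h := ZLattice.covolume_div_covolume_eq_relIndex' _ _ (constrA_le C)
  rw [← map_comap_reduction, ← map_top_scaleHom,
    AddSubgroup.relIndex_map_map_of_injective _ _ (scaleHom_injective n h0.ne'),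
    AddSubgroup.relIndex_top_right,
    AddSubgroup.index_comap_of_surjective _ (reduction_surjective n),
    covolume_scaledInt n h0] at h
  have hn := length_eq hC
  set k := Module.finrank (ZMod 2) C
  have hp : (1 / √2) ^ n = 1 / 2 ^ k := by
    conv_lhs => rw [hn]
    rw [pow_mul, div_pow, Real.sq_sqrt (by norm_num), one_pow, div_pow, one_pow]
  have hidx := C.toAddSubgroup.card_mul_index
  have hcard : (Nat.card C.toAddSubgroup : ℝ) = 2 ^ k := by
    rw [← card_code, Nat.card_eq_fintype_card]
    rfl
  have hidx' : (2 : ℝ) ^ k * C.toAddSubgroup.index = 2 ^ k * 2 ^ k := by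
    rw [← hcard]
    rw [← Nat.cast_mul, hidx, hcard, ← pow_add, ← two_mul, ← hn]
    simp
  have hidx'' := mul_left_cancel₀ (by positivity) hidx'
  rw [hp, hidx''] at h
  have : (2 : ℝ) ^ k ≠ 0 := by positivity
  field_simp at h
  exact h

end Covolume

section Ratio

/-! ### The quotient of the two coset sums -/

/-- The integers, by parity. -/
def parityEquiv : ℤ ⊕ ℤ ≃ ℤ where
  toFun := Sum.elim (fun z => 2 * z) (fun z => 1 + 2 * z)
  invFun v := if v % 2 = 0 then Sum.inl (v / 2) else Sum.inr (v / 2)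
  left_inv := by
    rintro (z | z)
    · have h : (2 * z) % 2 = 0 := by omega
      simp only [Sum.elim_inl, h, if_true]
      congr 1
      omega
    · have h : ¬ (1 + 2 * z) % 2 = 0 := by omega
      simp only [Sum.elim_inr, h, if_false]
      congr 1
      omega
  right_inv := by
    intro v
    by_cases h : v % 2 = 0
    · simp only [h, if_true, Sum.elim_inl]
      omega
    · simp only [h, if_false, Sum.elim_inr]
      omega

theorem theta3_eq_add {τ : ℝ} (hτ : 0 < τ) :
    theta3 τ = thetaCoset 0 (2 * τ) + thetaCoset 1 (2 * τ) := by
  have h2 : 0 < 2 * τ := by positivity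
  have h := hasSum_theta3 hτ
  rw [← parityEquiv.hasSum_iff] at h
  refine h.unique (HasSum.sum ?_ ?_)
  · refine (hasSum_thetaCoset 0 h2).congr_fun fun z => ?_
    simp [parityEquiv]
    ring
  · refine (hasSum_thetaCoset 1 h2).congr_fun fun z => ?_
    simp [parityEquiv, ZMod.val_one]
    ring

/-- Poisson summation for the even coset, with the dual sum over ℤ split by parity. -/
theorem sqrt_mul_thetaCoset_zero {τ : ℝ} (hτ : 0 < τ) :
    √(2 * τ) * thetaCoset 0 τ = thetaCoset 0 (1 / τ) + thetaCoset 1 (1 / τ) := by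
  have h2 : 0 < 2 * τ := by positivity
  have h := Real.tsum_exp_neg_mul_int_sq h2
  have hinv : theta3 (1 / (2 * τ)) = ∑' v : ℤ, Real.exp (-π / (2 * τ) * (v : ℝ) ^ 2) := by
    unfold theta3
    exact tsum_congr fun v => by rw [mul_one_div]
  rw [← hinv, theta3_eq_add (by positivity), ← Real.sqrt_eq_rpow] at h
  change theta3 (2 * τ) = _ at h
  have e : 2 * (1 / (2 * τ)) = 1 / τ := by field_simp
  have hs : √(2 * τ) ≠ 0 := (Real.sqrt_pos.2 h2).ne'
  rw [thetaCoset_zero_eq, h, e]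
  field_simp

theorem sqrt_div_mul_thetaCoset_zero {τ : ℝ} (hτ : 0 < τ) :
    √(2 / τ) * thetaCoset 0 (1 / τ) = thetaCoset 0 τ + thetaCoset 1 τ := by
  have h := sqrt_mul_thetaCoset_zero (one_div_pos.2 hτ)
  rwa [one_div_one_div, mul_one_div] at h

theorem sqrt_mul_sqrt_div {τ : ℝ} (hτ : 0 < τ) : √(2 * τ) * √(2 / τ) = 2 := by
  rw [← Real.sqrt_mul (by positivity), show 2 * τ * (2 / τ) = 2 ^ 2 by field_simp,
    Real.sqrt_sq (by norm_num)]

theorem thetaCoset_one_lt {τ : ℝ} (hτ : 0 < τ) : thetaCoset 1 τ < thetaCoset 0 τ := by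
  have h1 := sqrt_mul_thetaCoset_zero hτ
  have h2 := sqrt_div_mul_thetaCoset_zero hτ
  have h3 := sqrt_mul_sqrt_div hτ
  have h4 : 0 < √(2 / τ) * thetaCoset 1 (1 / τ) :=
    mul_pos (Real.sqrt_pos.2 (by positivity)) (thetaCoset_pos 1 (by positivity))
  -- Applying the transformation twice exhibits A - B as a positive multiple of the odd coset sum at
  -- 1/τ.
  have h5 : 2 * thetaCoset 0 τ =
      thetaCoset 0 τ + thetaCoset 1 τ + √(2 / τ) * thetaCoset 1 (1 / τ) := by
    linear_combination √(2 / τ) * h1 + h2 - thetaCoset 0 τ * h3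
  linarith

/-- The quotient of the two coset sums. -/
def cosetRatio (τ : ℝ) : ℝ := thetaCoset 1 τ / thetaCoset 0 τ

theorem cosetRatio_pos {τ : ℝ} (hτ : 0 < τ) : 0 < cosetRatio τ :=
  div_pos (thetaCoset_pos 1 hτ) (thetaCoset_pos 0 hτ)

theorem cosetRatio_mul_inv {τ : ℝ} (hτ : 0 < τ) :
    (1 + cosetRatio τ) * (1 + cosetRatio (1 / τ)) = 2 := by
  have h1 := sqrt_mul_thetaCoset_zero hτ
  have h2 := sqrt_div_mul_thetaCoset_zero hτ
  have h3 := sqrt_mul_sqrt_div hτ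
  have h4 := (thetaCoset_pos 0 hτ).ne'
  have h5 := (thetaCoset_pos 0 (one_div_pos.2 hτ)).ne'
  rw [cosetRatio, cosetRatio, one_add_div h4, one_add_div h5, div_mul_div_comm, ← h1, ← h2,
    div_eq_iff (mul_ne_zero h4 h5)]
  linear_combination thetaCoset 0 τ * thetaCoset 0 (1 / τ) * h3

theorem cosetRatio_one : cosetRatio 1 = √2 - 1 := by
  have h := cosetRatio_mul_inv one_pos
  rw [one_div_one, ← sq] at h
  have h0 : 0 ≤ 1 + cosetRatio 1 := by linarith [cosetRatio_pos one_pos]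
  rw [← h, Real.sqrt_sq h0]
  ring

/-- Summed over `z`, this bounds Σ 4z² exp(-2πz²) by half of ϑ₃(2i). Moving one step towards 0 gains
a factor exp(2π(2|z| - 1)) ≥ 16z². -/
theorem four_mul_sq_mul_exp_le (z : ℤ) :
    4 * (z : ℝ) ^ 2 * Real.exp (-π * 2 * (z : ℝ) ^ 2) ≤
      (Real.exp (-π * 2 * ((z - 1 : ℤ) : ℝ) ^ 2) +
        Real.exp (-π * 2 * ((z + 1 : ℤ) : ℝ) ^ 2)) / 4 := by
  have key {y : ℝ} (hy : 1 ≤ y) :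
      16 * y ^ 2 * Real.exp (-π * 2 * y ^ 2) ≤ Real.exp (-π * 2 * (y - 1) ^ 2) := by
    have e : -π * 2 * (y - 1) ^ 2 = π * (2 * y - 1) + π * (2 * y - 1) + -π * 2 * y ^ 2 := by ring
    rw [e, Real.exp_add (π * (2 * y - 1) + π * (2 * y - 1)), Real.exp_add]
    refine mul_le_mul_of_nonneg_right ?_ (Real.exp_pos _).le
    have h1 : 4 * y ≤ Real.exp (π * (2 * y - 1)) := by
      nlinarith [Real.add_one_le_exp (π * (2 * y - 1)), Real.pi_gt_three]
    nlinarith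
  rcases lt_trichotomy z 0 with h | rfl | h
  · have hz : (1 : ℝ) ≤ -z := by exact_mod_cast (by omega : (1 : ℤ) ≤ -z)
    have h1 := key hz
    have h2 := Real.exp_pos (-π * 2 * ((z - 1 : ℤ) : ℝ) ^ 2)
    rw [neg_sq, show (-(z : ℝ) - 1) ^ 2 = ((z + 1 : ℤ) : ℝ) ^ 2 by push_cast; ring] at h1
    linarith
  · simp
    positivity
  · have hz : (1 : ℝ) ≤ z := by exact_mod_cast (by omega : (1 : ℤ) ≤ z)
    have h1 := key hz
    have h2 := Real.exp_pos (-π * 2 * ((z + 1 : ℤ) : ℝ) ^ 2)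
    rw [show ((z : ℝ) - 1) ^ 2 = ((z - 1 : ℤ) : ℝ) ^ 2 by push_cast; ring] at h1
    linarith

/-- The even coset sum decays more slowly than exp(-π(τ-1)/2). After division by this rate, the
tangent bound exp(x) ≥ 1 + x in each term leaves a total of at least (1 + s/2) ϑ₃(2i). -/
theorem theta3_two_lt {τ : ℝ} (hτ : 1 < τ) :
    theta3 2 < Real.exp (π * (τ - 1) / 2) * theta3 (2 * τ) := by
  set s := π * (τ - 1) / 2 with hs
  have hs0 : 0 < s := div_pos (mul_pos Real.pi_pos (by linarith)) two_pos
  have h := hasSum_theta3 two_pos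
  have hm : HasSum (fun z : ℤ => Real.exp (-π * 2 * ((z - 1 : ℤ) : ℝ) ^ 2)) (theta3 2) :=
    (Equiv.subRight (1 : ℤ)).hasSum_iff.2 h
  have hp : HasSum (fun z : ℤ => Real.exp (-π * 2 * ((z + 1 : ℤ) : ℝ) ^ 2)) (theta3 2) :=
    (Equiv.addRight (1 : ℤ)).hasSum_iff.2 h
  have hl := h.add ((h.sub ((hm.add hp).div_const 4)).mul_left s)
  have hr := (hasSum_theta3 (show 0 < 2 * τ by linarith)).mul_left (Real.exp s)
  have hle := hasSum_le (fun z => ?_) hl hr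
  · nlinarith [mul_pos hs0 (theta3_pos two_pos)]
  · have e : Real.exp s * Real.exp (-π * (2 * τ) * (z : ℝ) ^ 2) =
        Real.exp (s * (1 - 4 * (z : ℝ) ^ 2)) * Real.exp (-π * 2 * (z : ℝ) ^ 2) := by
      rw [← Real.exp_add, ← Real.exp_add, hs]
      congr 1
      ring
    rw [e]
    have h1 := mul_le_mul_of_nonneg_right (Real.add_one_le_exp (s * (1 - 4 * (z : ℝ) ^ 2)))
      (Real.exp_pos (-π * 2 * (z : ℝ) ^ 2)).le
    have h2 := mul_le_mul_of_nonneg_left (four_mul_sq_mul_exp_le z) hs0.le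
    linarith

/-- Odd squares are at least 1, so every term of the odd coset sum decays at least at the rate
exp(-π(τ-1)/2). -/
theorem exp_mul_thetaCoset_one_le {τ : ℝ} (hτ : 1 < τ) :
    Real.exp (π * (τ - 1) / 2) * thetaCoset 1 τ ≤ thetaCoset 1 1 := by
  refine hasSum_le (fun z => ?_) ((hasSum_thetaCoset 1 (by linarith)).mul_left _)
    (hasSum_thetaCoset 1 one_pos)
  rw [← Real.exp_add, Real.exp_le_exp, ZMod.val_one, Nat.cast_one]
  have hz : (1 : ℝ) ≤ (1 + 2 * (z : ℝ)) ^ 2 := by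
    have : (1 : ℤ) ≤ (1 + 2 * z) ^ 2 := Int.add_one_le_iff.2 (sq_pos_of_ne_zero (by omega))
    exact_mod_cast this
  have h := mul_nonneg (mul_nonneg Real.pi_pos.le (sub_nonneg.2 hτ.le)) (sub_nonneg.2 hz)
  linarith

theorem cosetRatio_lt_of_one_lt {τ : ℝ} (hτ : 1 < τ) : cosetRatio τ < cosetRatio 1 := by
  have hτ0 : 0 < τ := by linarith
  have h1 := exp_mul_thetaCoset_one_le hτ
  have h2 := theta3_two_lt hτ
  have e := thetaCoset_zero_eq 1
  rw [mul_one] at e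
  rw [← e, ← thetaCoset_zero_eq] at h2
  rw [cosetRatio, cosetRatio, div_lt_div_iff₀ (thetaCoset_pos 0 hτ0) (thetaCoset_pos 0 one_pos)]
  calc thetaCoset 1 τ * thetaCoset 0 1
      < thetaCoset 1 τ * (Real.exp (π * (τ - 1) / 2) * thetaCoset 0 τ) :=
        mul_lt_mul_of_pos_left h2 (thetaCoset_pos 1 hτ0)
    _ = (Real.exp (π * (τ - 1) / 2) * thetaCoset 1 τ) * thetaCoset 0 τ := by ring
    _ ≤ thetaCoset 1 1 * thetaCoset 0 τ :=
        mul_le_mul_of_nonneg_right h1 (thetaCoset_pos 0 hτ0).le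

theorem cosetRatio_eq_iff {τ : ℝ} (hτ : 0 < τ) : cosetRatio τ = √2 - 1 ↔ τ = 1 := by
  rw [← cosetRatio_one]
  refine ⟨fun h => ?_, fun h => by rw [h]⟩
  rcases lt_trichotomy τ 1 with h1 | h1 | h1
  · have h2 := cosetRatio_lt_of_one_lt (one_lt_one_div hτ h1)
    have h3 := cosetRatio_mul_inv hτ
    have h4 := cosetRatio_mul_inv one_pos
    rw [one_div_one] at h4
    rw [h] at h3
    have h5 := cosetRatio_pos one_pos
    -- The factors 1 + r(1) and 1 + r(1/τ) would have product 2 = (1 + r(1))², although r(1/τ) <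
    -- r(1).
    nlinarith
  · exact h1
  · exact absurd h (cosetRatio_lt_of_one_lt h1).ne

/-! ### The theta series of a Construction A lattice -/

/-- The argument at which `f_C` gives the theta series ratio at `τ`. -/
def thetaParam (τ : ℝ) : ℝ :=
  (thetaCoset 0 τ ^ 2 - thetaCoset 1 τ ^ 2) / (thetaCoset 0 τ ^ 2 + thetaCoset 1 τ ^ 2)

theorem thetaParam_mem {τ : ℝ} (hτ : 0 < τ) : thetaParam τ ∈ Set.Icc (0 : ℝ) 1 := by
  have hA := thetaCoset_pos 0 hτ
  have hB := thetaCoset_pos 1 hτ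
  have hAB := thetaCoset_one_lt hτ
  constructor
  · exact div_nonneg (by nlinarith) (by positivity)
  · exact div_le_one_of_le₀ (by nlinarith) (by positivity)

theorem thetaParam_eq_iff {τ : ℝ} (hτ : 0 < τ) : thetaParam τ = 1 / √2 ↔ τ = 1 := by
  rw [← cosetRatio_eq_iff hτ]
  have hA := thetaCoset_pos 0 hτ
  have hr := cosetRatio_pos hτ
  have h2 : √2 ^ 2 = 2 := Real.sq_sqrt (by norm_num)
  have h20 : 0 < √2 := by positivity
  have h21 : 1 < √2 := by nlinarith
  have e : thetaParam τ = (1 - cosetRatio τ ^ 2) / (1 + cosetRatio τ ^ 2) := by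
    rw [thetaParam, cosetRatio]
    field_simp
  rw [e, div_eq_div_iff (by positivity) h20.ne']
  constructor
  · intro h
    -- The equation √2(1 - r²) = 1 + r² reads (1 + √2) r² = √2 - 1 = (1 + √2)(√2 - 1)².
    have h3 : (1 + √2) * (cosetRatio τ ^ 2 - (√2 - 1) ^ 2) = 0 := by
      linear_combination -h + (1 - √2) * h2
    have h4 := (mul_eq_zero.1 h3).resolve_left (by positivity)
    have h5 : cosetRatio τ ^ 2 = (√2 - 1) ^ 2 := by linarith
    exact (pow_left_inj₀ hr.le (by linarith) two_ne_zero).1 h5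
  · intro h
    rw [h]
    linear_combination (1 - √2) * h2

variable {n : ℕ} {C : Submodule (ZMod 2) (Fin n → ZMod 2)}

theorem theta_constrA_eq (hC : IsSelfDual C) {τ : ℝ} (hτ : 0 < τ) :
    theta (constrA C) τ =
      theta3 τ ^ n * (codeFun C (thetaParam τ) / 2 ^ Module.finrank (ZMod 2) C) := by
  have hA := thetaCoset_pos 0 hτ
  have hB := thetaCoset_pos 1 hτ
  have h3 := theta3_pos hτ
  have hsq := theta3_sq hτ
  have h20 : 0 < √2 := by positivity
  have h2 : √2 ^ 2 = 2 := Real.sq_sqrt (by norm_num)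
  have hs : theta3 τ / √2 = √(theta3 τ ^ 2 / 2) := by
    rw [Real.sqrt_div' _ (by norm_num), Real.sqrt_sq h3.le]
  have eA : theta3 τ / √2 * √(1 + thetaParam τ) = thetaCoset 0 τ := by
    have e : theta3 τ ^ 2 / 2 * (1 + thetaParam τ) = thetaCoset 0 τ ^ 2 := by
      rw [hsq, thetaParam]
      field_simp
      ring
    rw [hs, ← Real.sqrt_mul (by positivity), e, Real.sqrt_sq hA.le]
  have eB : theta3 τ / √2 * √(1 - thetaParam τ) = thetaCoset 1 τ := by
    have e : theta3 τ ^ 2 / 2 * (1 - thetaParam τ) = thetaCoset 1 τ ^ 2 := by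
      rw [hsq, thetaParam]
      field_simp
      ring
    rw [hs, ← Real.sqrt_mul (by positivity), e, Real.sqrt_sq hB.le]
  have hp : √2 ^ n = 2 ^ Module.finrank (ZMod 2) C := by
    conv_lhs => rw [length_eq hC]
    rw [pow_mul, h2]
  rw [theta_constrA C hτ, ← eA, ← eB, weightEnumerator_mul, div_pow, hp, codeFun]
  ring

theorem thetaRatio_constrA_eq (hC : IsSelfDual C) {τ : ℝ} (hτ : 0 < τ) :
    thetaRatio (constrA C) τ =
      codeFun C (thetaParam τ) / 2 ^ Module.finrank (ZMod 2) C := by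
  rw [thetaRatio, covolume_constrA hC, Real.one_rpow, theta_scaledInt_one hτ,
    theta_constrA_eq hC hτ, mul_div_cancel_left₀ _ (pow_pos (theta3_pos hτ) n).ne']

/-! ### U-shaped functions -/

variable {f : ℝ → ℝ} {a b t₀ : ℝ}

theorem IsUShaped.strictAntiOn (hf : IsUShaped f a b t₀) : StrictAntiOn f (Set.Icc a t₀) := by
  have hsub : Set.Icc a t₀ ⊆ Set.Icc a b := Set.Icc_subset_Icc_right hf.mem.2
  refine strictAntiOn_of_deriv_neg (convex_Icc a t₀) (hf.diff.continuousOn.mono hsub) fun t ht => ?_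
  rw [interior_Icc] at ht
  rw [← derivWithin_of_mem_nhds (Icc_mem_nhds ht.1 (ht.2.trans_le hf.mem.2))]
  exact hf.neg t ht.1 ht.2

theorem IsUShaped.strictMonoOn (hf : IsUShaped f a b t₀) : StrictMonoOn f (Set.Icc t₀ b) := by
  have hsub : Set.Icc t₀ b ⊆ Set.Icc a b := Set.Icc_subset_Icc_left hf.mem.1
  refine strictMonoOn_of_deriv_pos (convex_Icc t₀ b) (hf.diff.continuousOn.mono hsub) fun t ht => ?_
  rw [interior_Icc] at ht
  rw [← derivWithin_of_mem_nhds (Icc_mem_nhds (hf.mem.1.trans_lt ht.1) ht.2)]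
  exact hf.pos t ht.1 ht.2

theorem IsUShaped.le_max (hf : IsUShaped f a b t₀) {t : ℝ} (ht : t ∈ Set.Icc a b) :
    f t ≤ max (f a) (f b) := by
  rcases le_total t t₀ with h | h
  · exact le_max_of_le_left (hf.strictAntiOn.antitoneOn ⟨le_rfl, hf.mem.1⟩ ⟨ht.1, h⟩ ht.1)
  · exact le_max_of_le_right (hf.strictMonoOn.monotoneOn ⟨h, ht.2⟩ ⟨hf.mem.2, le_rfl⟩ ht.2)

theorem IsUShaped.lt_of_ne (hf : IsUShaped f a b t₀) {t : ℝ} (ht : t ∈ Set.Icc a b)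
    (hne : t ≠ t₀) : f t₀ < f t := by
  rcases lt_or_gt_of_ne hne with h | h
  · exact hf.strictAntiOn ⟨ht.1, h.le⟩ ⟨hf.mem.1, le_rfl⟩ h
  · exact hf.strictMonoOn ⟨le_rfl, hf.mem.2⟩ ⟨h.le, ht.2⟩ h

theorem hPoly_one_div_sqrt_two : hPoly (1 / √2) = 3 / 4 := by
  have h : (1 / √2) ^ 2 = 1 / 2 := by
    rw [div_pow, Real.sq_sqrt (by norm_num), one_pow]
  have h4 : (1 / √2) ^ 4 = 1 / 4 := by
    rw [show 4 = 2 * 2 from rfl, pow_mul, h]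
    norm_num
  rw [hPoly, h4, h]
  norm_num

end Ratio

end SelfDualTheta

end

theorem mainTheorem7 (n : ℕ) (C : Submodule (ZMod 2) (Fin n → ZMod 2))
    (hC : SelfDualTheta.IsSelfDual C) :
    ∃ a : Fin (n / 8 + 1) → ℚ,
      SelfDualTheta.IsCoeff C a ∧
      (∀ b : Fin (n / 8 + 1) → ℚ, SelfDualTheta.IsCoeff C b → b = a) ∧
      ∑ r, a r = 1 ∧
      (SelfDualTheta.IsUShaped (SelfDualTheta.codeFun C) 0 1 (1 / √2) →
        (∀ τ : ℝ, 0 < τ →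
          SelfDualTheta.theta3 τ ^ n * ∑ r, (a r : ℝ) * (3 / 4 : ℝ) ^ (r : ℕ)
              ≤ SelfDualTheta.theta (SelfDualTheta.constrA C) τ ∧
          SelfDualTheta.theta (SelfDualTheta.constrA C) τ ≤ SelfDualTheta.theta3 τ ^ n ∧
          SelfDualTheta.theta (SelfDualTheta.constrA C) τ
              ≤ SelfDualTheta.theta (SelfDualTheta.scaledInt n 1) τ ∧
          SelfDualTheta.thetaRatio (SelfDualTheta.constrA C) τ ≤ 1) ∧
        {τ : ℝ | 0 < τ ∧ ∀ σ : ℝ, 0 < σ →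
          SelfDualTheta.thetaRatio (SelfDualTheta.constrA C) τ
            ≤ SelfDualTheta.thetaRatio (SelfDualTheta.constrA C) σ} = {1}) := by
  obtain ⟨a, ha⟩ := SelfDualTheta.exists_isCoeff hC
  refine ⟨a, ha, fun b hb => SelfDualTheta.isCoeff_unique ha hb,
    SelfDualTheta.sum_eq_one_of_isCoeff ha, fun hU => ?_⟩
  have hk : (0 : ℝ) < 2 ^ Module.finrank (ZMod 2) C := by positivity
  have hmin {τ : ℝ} (hτ : 0 < τ) (h1 : τ ≠ 1) : SelfDualTheta.codeFun C (1 / √2) <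
      SelfDualTheta.codeFun C (SelfDualTheta.thetaParam τ) :=
    hU.lt_of_ne (SelfDualTheta.thetaParam_mem hτ)
      fun h => h1 ((SelfDualTheta.thetaParam_eq_iff hτ).1 h)
  have hone := (SelfDualTheta.thetaParam_eq_iff one_pos).2 rfl
  have hle {τ : ℝ} (hτ : 0 < τ) : SelfDualTheta.codeFun C (1 / √2) ≤
      SelfDualTheta.codeFun C (SelfDualTheta.thetaParam τ) := by
    rcases eq_or_ne τ 1 with rfl | h
    · rw [hone]
    · exact (hmin hτ h).le
  refine ⟨fun τ hτ => ?_, ?_⟩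
  · have hpos : 0 < SelfDualTheta.theta3 τ ^ n := pow_pos (SelfDualTheta.theta3_pos hτ) n
    have hmax : SelfDualTheta.codeFun C (SelfDualTheta.thetaParam τ) /
        2 ^ Module.finrank (ZMod 2) C ≤ 1 := by
      rw [div_le_one hk]
      have := hU.le_max (SelfDualTheta.thetaParam_mem hτ)
      rwa [SelfDualTheta.codeFun_zero, SelfDualTheta.codeFun_one hC, max_self] at this
    -- The expansion at t = 1/√2 identifies the minimum of f_C with 2^k Σ a_r (3/4)^r.
    have hval := ha _ hU.mem
    rw [SelfDualTheta.hPoly_one_div_sqrt_two] at hval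
    have hupper : SelfDualTheta.theta (SelfDualTheta.constrA C) τ ≤
        SelfDualTheta.theta3 τ ^ n := by
      rw [SelfDualTheta.theta_constrA_eq hC hτ]
      exact mul_le_of_le_one_right hpos.le hmax
    refine ⟨?_, hupper, ?_, ?_⟩
    · rw [SelfDualTheta.theta_constrA_eq hC hτ]
      refine mul_le_mul_of_nonneg_left ?_ hpos.le
      rw [le_div_iff₀ hk, mul_comm, ← hval]
      exact hle hτ
    · rwa [SelfDualTheta.theta_scaledInt_one hτ]
    · rwa [SelfDualTheta.thetaRatio_constrA_eq hC hτ]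
  · ext τ
    simp only [Set.mem_ofPred_eq, Set.mem_singleton_iff]
    constructor
    · rintro ⟨hτ, h⟩
      by_contra hne
      have h1 := h 1 one_pos
      rw [SelfDualTheta.thetaRatio_constrA_eq hC hτ,
        SelfDualTheta.thetaRatio_constrA_eq hC one_pos, hone, div_le_div_iff_of_pos_right hk] at h1
      exact absurd (hmin hτ hne) h1.not_gt
    · rintro rfl
      refine ⟨one_pos, fun σ hσ => ?_⟩
      rw [SelfDualTheta.thetaRatio_constrA_eq hC hσ,
        SelfDualTheta.thetaRatio_constrA_eq hC one_pos, hone, div_le_div_iff_of_pos_right hk]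
      exact hle hσ
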